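/- **Conventions.** Let $m,n\ge 1$, let $K$ be a locally contractible topological group (every neighbourhood of a point contains a smaller neighbourhood whose inclusion is null-homotopic), and let $\eta\colon P\to S^m$ be a continuous (locally trivial) principal $K$-bundle, with $K$ acting from the right. Write $I=[0,1]$; elements of $\pi_k(X,x)$ are homotopy classes rel $\partial I^k$ of maps $(I^k,\partial I^k)\to (X,x)$; groups $\pi_k$ are written additively, and $\pi_k(K)=\pi_k(K,e)$. *Characteristic class.* Let $q\colon I^m\to S^m$ be a quotient map that collapses $\partial I^m$ to a point and is otherwise injective, let $\sigma\colon I^m\to P$ be continuous with $\eta\circ\sigma=q$, put $y_0=(1,\tfrac12,\dots,\tfrac12)\in\partial I^m$ and $p_0=\sigma(y_0)$, and let $\gamma\colon\partial I^m\to K$ be the continuous map with $\sigma(y)\cdot\gamma(y)=\sigma(y_0)$ (a characteristic map of $P$). Let $b\in\pi_{m-1}(K)$ be its class: $\gamma$ is homotopic rel $y_0$ to a map $\gamma'$ that is $e$ at all points $(t,y)\in\partial I^m$, $t\in I$, $y\in I^{m-1}$, with $t\neq 0$, and for which $y\mapsto\gamma'(0,y)$ represents $b$. *Evaluation fibration.*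 Let $\mathrm{Gau}(P)\cong C(P,K)^K=\{f\in C(P,K): f(p\cdot k)=k^{-1}f(p)k\ \ \forall p\in P,\,k\in K\}$ with the compact-open topology ($f$ corresponds to the gauge transformation $p\mapsto p\cdot f(p)$), let $\mathrm{ev}\colon C(P,K)^K\to K$, $f\mapsto f(p_0)$, and let $F=\mathrm{ev}^{-1}(e)$. *Connecting map.* For $a=[\alpha]\in\pi_n(K)$ choose a lift $A\colon I^n\to C(P,K)^K$ of $\alpha$ (that is, $\mathrm{ev}\circ A=\alpha$) which is constantly $e$ on all faces of $I^n$ except $I^{n-1}\times\{0\}$; the connecting map sends $a$ to the class of $A|_{I^{n-1}\times\{0\}}$ in $\pi_{n-1}(F)$. *Samelson product.* For $a=[\alpha]\in\pi_n(K)$ and $b=[\beta]\in\pi_{m-1}(K)$, $\langle a,b\rangle\in\pi_{n+m-1}(K)$ is the class of $I^n\times I^{m-1}\to K$, $(x,y)\mapsto\alpha(x)\beta(y)\alpha(x)^{-1}\beta(y)^{-1}$. **Theorem.** The evaluation map $\mathrm{ev}$ is a Serre fibration, and $f\mapsto f\circ\sigma$ is a homeomorphism from its fibre $F$ onto $C_*(I^m/\partial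 I^m,K)= C_*(S^m,K)$. The connecting map $\pi_n(K)\to\pi_{n-1}(F)$ is well defined (every $\alpha$ has a lift $A$ as above, and the resulting class depends only on $[\alpha]$). Let $\delta_n\colon\pi_n(K)\to\pi_{n+m-1}(K)$ be its composition with the identification $\pi_{n-1}(F)\cong\pi_{n-1}(C_*(S^m,K))\cong\pi_{n+m-1}(K)$, where the second map is $[u]\mapsto[(x,z)\mapsto u(x)(z)]$ with $(x,z)\in I^{n-1}\times I^m=I^{n+m-1}$. Then for all $a\in\pi_n(K)$ $$\delta_n(a)=-\langle a,b\rangle .$$ -/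

import Mathlib

open scoped Topology unitInterval Topology.Homotopy

noncomputable section

namespace SamelsonGauge

/-! ### Homotopy groups: induced maps, reindexing, iterated loops, Samelson product -/

/-- The map on homotopy classes induced by a pointed map `f : (X, x) → (Y, y)`. -/
def inducedMap (N : Type*) {X Y : Type*} [TopologicalSpace X] [TopologicalSpace Y]
    {x : X} {y : Y} (f : C(X, Y)) (hf : f x = y) : HomotopyGroup N X x → HomotopyGroup N Y y :=
  Quotient.map (fun p : Ω^ N X x => (⟨f.comp p.1, fun t ht => by
      rw [ContinuousMap.comp_apply, p.2 t ht, hf]⟩ : Ω^ N Y y))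
    (fun _ _ h => ContinuousMap.HomotopicRel.comp_continuousMap h f)

/-- Reindexing of homotopy classes along a bijection of the coordinates of the cube. -/
def reindex {M N : Type*} {X : Type*} [TopologicalSpace X] {x : X} (e : M ≃ N) :
    HomotopyGroup M X x → HomotopyGroup N X x :=
  Quotient.map (GenLoop.congr x e) (by
    rintro p q ⟨H⟩
    refine ⟨⟨⟨⟨fun z => H (z.1, fun i => z.2 (e i)), by fun_prop⟩, ?_, ?_⟩, ?_⟩⟩
    · intro y; exact H.apply_zero _
    · intro y; exact H.apply_one _
    · rintro t y ⟨i, hi⟩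
      exact H.eq_fst t ⟨e.symm i, by simpa using hi⟩)

/-- The map `π_M(Ω^N X) → π_{M ⊔ N}(X)` given by the exponential law: the class of
`u : I^M → Ω^N X` is sent to the class of `(s, t) ↦ u(s)(t)`. -/
def adjunction (M N : Type*) {X : Type*} [TopologicalSpace X] (x : X) :
    HomotopyGroup M (Ω^ N X x) GenLoop.const → HomotopyGroup (M ⊕ N) X x :=
  Quotient.map (GenLoop.genLoopGenLoopEquiv x) (by
    rintro p q ⟨H⟩
    refine ⟨⟨⟨⟨fun z => (H (z.1, fun i => z.2 (Sum.inl i))) (fun j => z.2 (Sum.inr j)),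
      by fun_prop⟩, ?_, ?_⟩, ?_⟩⟩
    · intro y
      exact congrArg (fun g : Ω^ N X x => g (fun j => y (Sum.inr j))) (H.apply_zero _)
    · intro y
      exact congrArg (fun g : Ω^ N X x => g (fun j => y (Sum.inr j))) (H.apply_one _)
    · intro t y hy
      rcases Cube.boundary_sum_iff.mp hy with h | h
      · exact congrArg (fun g : Ω^ N X x => g (fun j => y (Sum.inr j))) (H.eq_fst t h)
      · exact ((H (t, fun i => y (Sum.inl i))).2 _ h).trans
          ((p.1 (fun i => y (Sum.inl i))).2 _ h).symm)

/-- The commutator map `(s, t) ↦ α(s) β(t) α(s)⁻¹ β(t)⁻¹` on the product of two cubes. -/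
def commutatorLoop {M N : Type*} {K : Type*} [Group K] [TopologicalSpace K] [IsTopologicalGroup K]
    (α : Ω^ M K (1 : K)) (β : Ω^ N K (1 : K)) : Ω^ (M ⊕ N) K (1 : K) :=
  ⟨⟨fun y => α (y ∘ Sum.inl) * β (y ∘ Sum.inr) * (α (y ∘ Sum.inl))⁻¹ * (β (y ∘ Sum.inr))⁻¹, by
    have h1 : Continuous fun y : M ⊕ N → I => α (y ∘ Sum.inl) :=
      α.1.continuous.comp (by fun_prop)
    have h2 : Continuous fun y : M ⊕ N → I => β (y ∘ Sum.inr) :=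
      β.1.continuous.comp (by fun_prop)
    fun_prop⟩, by
    intro y hy
    rcases Cube.boundary_sum_iff.mp hy with h | h
    · have : α (y ∘ Sum.inl) = 1 := α.2 _ h
      simp [this]
    · have : β (y ∘ Sum.inr) = 1 := β.2 _ h
      simp [this]⟩

/-- The Samelson product `⟨a, b⟩`, represented by the commutator map of representatives. -/
def samelson {M N : Type*} {K : Type*} [Group K] [TopologicalSpace K] [IsTopologicalGroup K] :
    HomotopyGroup M K (1 : K) → HomotopyGroup N K (1 : K) → HomotopyGroup (M ⊕ N) K (1 : K) :=
  Quotient.map₂ commutatorLoop (by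
    rintro α α' ⟨A⟩ β β' ⟨B⟩
    have h1 : Continuous fun z : I × (M ⊕ N → I) => A (z.1, z.2 ∘ Sum.inl) :=
      A.continuous.comp (by fun_prop)
    have h2 : Continuous fun z : I × (M ⊕ N → I) => B (z.1, z.2 ∘ Sum.inr) :=
      B.continuous.comp (by fun_prop)
    refine ⟨⟨⟨⟨fun z => A (z.1, z.2 ∘ Sum.inl) * B (z.1, z.2 ∘ Sum.inr) *
      (A (z.1, z.2 ∘ Sum.inl))⁻¹ * (B (z.1, z.2 ∘ Sum.inr))⁻¹, by fun_prop⟩, ?_, ?_⟩, ?_⟩⟩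
    · intro y
      simp only [ContinuousMap.HomotopyWith.apply_zero]
      rfl
    · intro y
      simp only [ContinuousMap.HomotopyWith.apply_one]
      rfl
    · intro t y hy
      refine Eq.trans ?_ ((commutatorLoop α β).2 y hy).symm
      rcases Cube.boundary_sum_iff.mp hy with h | h
      · have e : A (t, y ∘ Sum.inl) = 1 := (A.eq_fst t h).trans (α.2 _ h)
        simp [e]
      · have e : B (t, y ∘ Sum.inr) = 1 := (B.eq_fst t h).trans (β.2 _ h)
        simp [e])

/-! ### Fibrations and the connecting map -/

/-- `p : E → B` has the homotopy lifting property with respect to all cubes. -/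
def IsSerreFibration {E B : Type*} [TopologicalSpace E] [TopologicalSpace B] (p : C(E, B)) : Prop :=
  ∀ (k : ℕ) (H : C((I^ (Fin k)) × I, B)) (f : C(I^ (Fin k), E)), (∀ x, p (f x) = H (x, 0)) →
    ∃ G : C((I^ (Fin k)) × I, E), (∀ x, G (x, 0) = f x) ∧ ∀ z, p (G z) = H z

/-- `F : I^{n+1} → E` is a lift of `α : (I^{n+1}, ∂I^{n+1}) → (B, b₀)` that is constantly `e₀` on
all faces of the cube other than the face on which the last coordinate is `0`. -/
structure IsLift {E B : Type*} [TopologicalSpace E] [TopologicalSpace B] (p : C(E, B))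
    (e₀ : E) {b₀ : B} {n : ℕ} (α : Ω^ (Fin (n + 1)) B b₀) (F : C(I^ (Fin (n + 1)), E)) : Prop where
  proj : ∀ y, p (F y) = α y
  last_eq_one : ∀ y, y (Fin.last n) = 1 → F y = e₀
  side : ∀ y, (∃ i : Fin n, y i.castSucc = 0 ∨ y i.castSucc = 1) → F y = e₀

/-- The restriction of a lift to the face on which the last coordinate is `0`, as an `n`-dimensional
loop in the fibre `p⁻¹(b₀)`. -/
def IsLift.bottom {E B : Type*} [TopologicalSpace E] [TopologicalSpace B] {p : C(E, B)}
    {e₀ : E} {b₀ : B} (h₀ : p e₀ = b₀) {n : ℕ} {α : Ω^ (Fin (n + 1)) B b₀}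
    {F : C(I^ (Fin (n + 1)), E)} (hF : IsLift p e₀ α F) :
    Ω^ (Fin n) (p ⁻¹' {b₀}) ⟨e₀, h₀⟩ :=
  have hmem : ∀ x : I^ (Fin n), F (Fin.snoc x 0) ∈ p ⁻¹' {b₀} := fun x => by
    rw [Set.mem_preimage, Set.mem_singleton_iff, hF.proj]
    exact α.2 _ ⟨Fin.last n, Or.inl (by simp)⟩
  ⟨⟨fun x => ⟨F (Fin.snoc x 0), hmem x⟩,
    Continuous.subtype_mk (F.continuous.comp (by fun_prop)) hmem⟩, by
    rintro x ⟨i, hi⟩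
    exact Subtype.ext (hF.side (Fin.snoc x 0) ⟨i, by simpa using hi⟩)⟩

/-- `δ : π_{n+1}(B, b₀) → π_n(p⁻¹(b₀), e₀)` is the connecting map of the long exact homotopy
sequence of `p : E → B`: every representative of a class in `π_{n+1}(B, b₀)` has a lift, and
`δ` sends the class to the class of the restriction of any such lift. There is at most one
such `δ`. -/
def IsConnectingMap {E B : Type*} [TopologicalSpace E] [TopologicalSpace B] (p : C(E, B))
    {e₀ : E} {b₀ : B} (h₀ : p e₀ = b₀) (n : ℕ)
    (δ : π_ (n + 1) B b₀ → π_ n (p ⁻¹' {b₀}) ⟨e₀, h₀⟩) : Prop :=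
  ∀ α : Ω^ (Fin (n + 1)) B b₀,
    (∃ F, IsLift p e₀ α F) ∧
      ∀ (F : C(I^ (Fin (n + 1)), E)) (hF : IsLift p e₀ α F),
        δ (Quotient.mk _ α) = Quotient.mk _ (hF.bottom h₀)

/-! ### Principal bundles and gauge groups

A right action of `K` on `P` is a left action of `Kᵐᵒᵖ`; `p · k` is `MulOpposite.op k • p`. -/

/-- `η : P → B` is a continuous (locally trivial) principal `K`-bundle. -/
structure IsPrincipalBundle (K : Type*) [Group K] [TopologicalSpace K]
    {P B : Type*} [TopologicalSpace P] [TopologicalSpace B] [MulAction Kᵐᵒᵖ P]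
    (η : P → B) : Prop where
  continuous_act : Continuous fun z : P × K => MulOpposite.op z.2 • z.1
  proj_act : ∀ (p : P) (k : K), η (MulOpposite.op k • p) = η p
  locally_trivial : ∀ x : B, ∃ e : Bundle.Trivialization K η, x ∈ e.baseSet ∧
    ∀ p : P, η p ∈ e.baseSet → ∀ k : K, e (MulOpposite.op k • p) = ((e p).1, (e p).2 * k)

/-- The gauge group, in the form `C(P, K)^K` of continuous maps `f : P → K` with
`f(p · k) = k⁻¹ f(p) k` (the gauge transformation belonging to `f` is `p ↦ p · f(p)`). It carries
pointwise multiplication and the compact-open topology. -/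
def gaugeGroup (K P : Type*) [Group K] [TopologicalSpace K] [IsTopologicalGroup K]
    [TopologicalSpace P] [MulAction Kᵐᵒᵖ P] : Subgroup C(P, K) where
  carrier := {f | ∀ (p : P) (k : K), f (MulOpposite.op k • p) = k⁻¹ * f p * k}
  mul_mem' := by
    intro f g hf hg p k
    simp only [ContinuousMap.mul_apply, hf p k, hg p k]
    group
  one_mem' := by
    intro p k
    simp
  inv_mem' := by
    intro f hf p k
    simp only [ContinuousMap.inv_apply, hf p k]
    group

/-- The evaluation map `ev_{p₀} : C(P, K)^K → K`. -/
def evaluation (K : Type*) {P : Type*} [Group K] [TopologicalSpace K] [IsTopologicalGroup K]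
    [TopologicalSpace P] [MulAction Kᵐᵒᵖ P] (p₀ : P) : C(gaugeGroup K P, K) :=
  ⟨fun f => f.1 p₀, (ContinuousEvalConst.continuous_eval_const p₀).comp continuous_subtype_val⟩

theorem evaluation_one (K : Type*) {P : Type*} [Group K] [TopologicalSpace K]
    [IsTopologicalGroup K] [TopologicalSpace P] [MulAction Kᵐᵒᵖ P] (p₀ : P) :
    evaluation K p₀ 1 = 1 := rfl

/-! ### Characteristic maps of bundles over spheres -/

/-- The sphere `S^m`. -/
abbrev Sph (m : ℕ) : Type := Metric.sphere (0 : EuclideanSpace ℝ (Fin (m + 1))) 1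

/-- The base point `(1, 1/2, …, 1/2)` of the cube `[0,1]^{m+1}`, the centre of the face on which the
first coordinate is `1`. In the coordinates of `[-1,1]^{m+1}` it is `(1, 0, …, 0)`. -/
def cubeBase (m : ℕ) : I^ (Fin (m + 1)) :=
  Fin.cons 1 fun _ => ⟨1 / 2, by norm_num, by norm_num⟩

theorem cubeBase_mem (m : ℕ) : cubeBase m ∈ Cube.boundary (Fin (m + 1)) :=
  ⟨0, Or.inr rfl⟩

/-- A characteristic map (clutching function) `clutch : ∂I^{m+1} → K` of a bundle `η : P → S^{m+1}`,
together with the map `sec : I^{m+1} → P` that determines it. -/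
structure CharacteristicMap (K : Type*) [Group K] [TopologicalSpace K] {P : Type*}
    [TopologicalSpace P] [MulAction Kᵐᵒᵖ P] {m : ℕ} (η : P → Sph (m + 1)) where
  /-- The quotient map collapsing the boundary of the cube to a point. -/
  q : C(I^ (Fin (m + 1)), Sph (m + 1))
  q_surjective : Function.Surjective q
  q_eq_iff : ∀ x y, q x = q y ↔
    x = y ∨ (x ∈ Cube.boundary (Fin (m + 1)) ∧ y ∈ Cube.boundary (Fin (m + 1)))
  /-- A lift of the quotient map to the total space. -/
  sec : C(I^ (Fin (m + 1)), P)
  proj_sec : ∀ x, η (sec x) = q x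
  /-- The characteristic map, determined by `sec(y) · clutch(y) = sec(y₀)`. -/
  clutch : C(Cube.boundary (Fin (m + 1)), K)
  sec_act_clutch : ∀ y : Cube.boundary (Fin (m + 1)), MulOpposite.op (clutch y) • sec y = sec (cubeBase m)

namespace CharacteristicMap

variable {K : Type*} [Group K] [TopologicalSpace K] {P : Type*}
  [TopologicalSpace P] [MulAction Kᵐᵒᵖ P] {m : ℕ} {η : P → Sph (m + 1)}

/-- `clutch` represents `b ∈ π_m(K)`. Here `∂I^{m+1}` modulo all of its faces except the
face `{0} × I^m` is identified with `I^m / ∂I^m` by `(0, y) ↦ y`: up to a homotopy relative to the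
base point, `clutch` is trivial off this face, and on this face it is a representative of `b`. -/
def Represents (c : CharacteristicMap K η) (b : π_ m K (1 : K)) : Prop :=
  ∃ (β : Ω^ (Fin m) K (1 : K)) (γ' : C(Cube.boundary (Fin (m + 1)), K)),
    b = Quotient.mk _ β ∧
    c.clutch.HomotopicRel γ' {⟨cubeBase m, cubeBase_mem m⟩} ∧
    (∀ y : Cube.boundary (Fin (m + 1)), y.1 0 = 0 → γ' y = β (Fin.tail y.1)) ∧
    (∀ y : Cube.boundary (Fin (m + 1)), y.1 0 ≠ 0 → γ' y = 1)

variable [IsTopologicalGroup K]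

/-- The fibre over `1` of the evaluation at `p₀ = sec(y₀)`: the gauge maps with `f(p₀) = 1`. -/
abbrev PointedGauge (c : CharacteristicMap K η) : Type _ :=
  evaluation K (c.sec (cubeBase m)) ⁻¹' {1}

theorem apply_sec_boundary (c : CharacteristicMap K η) (f : c.PointedGauge)
    (y : I^ (Fin (m + 1))) (hy : y ∈ Cube.boundary (Fin (m + 1))) :
    f.1.1 (c.sec y) = 1 := by
  have h1 : f.1.1 (c.sec (cubeBase m)) = 1 := f.2
  have h2 := f.1.2 (c.sec y) (c.clutch ⟨y, hy⟩)
  rw [c.sec_act_clutch ⟨y, hy⟩, h1] at h2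
  have h3 := congrArg (fun z => c.clutch ⟨y, hy⟩ * z * (c.clutch ⟨y, hy⟩)⁻¹) h2
  simpa [mul_assoc] using h3.symm

/-- The comparison map `f ↦ f ∘ sec` from the fibre of the evaluation map to
`C_*(S^{m+1}, K) = C_*(I^{m+1}/∂I^{m+1}, K)`. -/
def fibreMap (c : CharacteristicMap K η) : C(c.PointedGauge, Ω^ (Fin (m + 1)) K (1 : K)) where
  toFun f := ⟨f.1.1.comp c.sec, fun y hy => c.apply_sec_boundary f y hy⟩
  continuous_toFun := Continuous.subtype_mk
    ((ContinuousMap.continuous_precomp c.sec).comp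
      (continuous_subtype_val.comp continuous_subtype_val))
    fun f y hy => c.apply_sec_boundary f y hy

theorem fibreMap_one (c : CharacteristicMap K η) :
    c.fibreMap ⟨1, evaluation_one K _⟩ = GenLoop.const := rfl

/-- The identification `π_n(fibre) ≅ π_n(C_*(S^{m+1}, K)) ≅ π_{n+m+1}(K)`, the second map being
`[u] ↦ [(x, z) ↦ u(x)(z)]` for `(x, z) ∈ I^n × I^{m+1} = I^{n+m+1}`. -/
def fibreIdentification (c : CharacteristicMap K η) (n : ℕ) :
    π_ n c.PointedGauge ⟨1, evaluation_one K _⟩ → π_ (n + m + 1) K (1 : K) :=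
  fun u => reindex (finSumFinEquiv (m := n) (n := m + 1))
    (adjunction (Fin n) (Fin (m + 1)) (1 : K) (inducedMap (Fin n) c.fibreMap c.fibreMap_one u))

end CharacteristicMap

/-- The Samelson product `π_{n+1}(K) × π_m(K) → π_{n+m+1}(K)`, where `I^{n+m+1} = I^{n+1} × I^m`. -/
def samelsonProduct {K : Type*} [Group K] [TopologicalSpace K] [IsTopologicalGroup K] {n m : ℕ}
    (a : π_ (n + 1) K (1 : K)) (b : π_ m K (1 : K)) : π_ (n + m + 1) K (1 : K) :=
  reindex (finSumFinEquiv.trans (finCongr (by omega))) (samelson a b)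

end SamelsonGauge

end

/-!
Over the cube the bundle becomes trivial: every point of `P` is `sec(x) · k` with `x ∈ I^{m+1}`, and
`(x, k) ↦ sec(x) · k` is a proper surjection, hence stays a quotient map after taking the product
with any space (`isProperMap_param`). Writing `γ` for the clutching function, a continuous family of
gauge maps is therefore the same as a continuous family of maps `g : I^{m+1} → K` with
`g(y) = γ(y) g(y₀) γ(y)⁻¹` for `y ∈ ∂I^{m+1}` (`exists_gauge_family`). In particular, those with
`g(y₀) = 1` are the maps trivial on `∂I^{m+1}`, which gives the homeomorphism of the fibre with
`C_*(S^{m+1}, K)`. Lifting homotopies or loops along the evaluation at `y₀` amounts to extending a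
map from the bottom and the wall of a cylinder on a cube, and this is possible because they are a
retract of the cylinder (`exists_cylinder_extension`).

For the formula, let `F` be a lift of `α` and regard it as a map `G(x, y)` on
`I^{n+1} × I^{m+1}`. It is trivial on all faces `x_i ∈ {0, 1}` except `x_last = 0`, and it equals
`γ(y) α(x) γ(y)⁻¹` for `y ∈ ∂I^{m+1}`. By the same extension property `γ` may be replaced by the
homotopic map that is a representative `β` of `b` on the face `y_first = 0` and trivial elsewhere,
without changing `G` for `x ∈ ∂I^{n+1}` (`exists_deformed_lift`). Then `G(x, y) α(x)⁻¹` is trivial on all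
faces of `I^{n+1} × I^{m+1}` except two: on `x_last = 0` it is the bottom of the lift, and on
`y_first = 0` it is `β α β⁻¹ α⁻¹`, the pointwise inverse of the commutator map. The coordinates `x_last`
and `y_first` are adjacent, so sweeping out the square in these two coordinates is a homotopy between the
two restrictions, with the remaining coordinates in the same order (`homotopic_of_square`); there is
no further sign. Since the pointwise inverse represents the inverse in the homotopy group, the
identification sends the bottom of every lift to `-⟨a, b⟩` (`fibreIdentification_bottom`). As the
identification is injective, this also shows that the class of the bottom depends only on that
of `α`.
-/

noncomputable section

namespace SamelsonGauge

/-! ### Extending maps over a cylinder on a cube -/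

/-- The sup norm of a point of the cube in the coordinates `2y - 1` of `[-1,1]^M`. -/
def cubeRadius {M : Type*} [Fintype M] (y : I^ M) : ℝ :=
  ‖fun i => 2 * (y i : ℝ) - 1‖

theorem continuous_cubeRadius {M : Type*} [Fintype M] :
    Continuous (cubeRadius : (I^ M) → ℝ) := by
  unfold cubeRadius
  fun_prop

theorem abs_le_cubeRadius {M : Type*} [Fintype M] (y : I^ M) (i : M) :
    |2 * (y i : ℝ) - 1| ≤ cubeRadius y :=
  norm_le_pi_norm (fun i => 2 * (y i : ℝ) - 1) i

theorem cubeRadius_le_one {M : Type*} [Fintype M] (y : I^ M) : cubeRadius y ≤ 1 := by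
  refine (pi_norm_le_iff_of_nonneg zero_le_one).2 fun i => ?_
  rw [Real.norm_eq_abs, abs_le]
  constructor <;> linarith [(y i).2.1, (y i).2.2]

theorem cubeRadius_eq_one {M : Type*} [Fintype M] {y : I^ M} (hy : y ∈ Cube.boundary M) :
    cubeRadius y = 1 := by
  refine le_antisymm (cubeRadius_le_one y) ?_
  obtain ⟨i, hi⟩ := hy
  refine le_trans ?_ (abs_le_cubeRadius y i)
  rcases hi with h | h <;> norm_num [h]

theorem exists_abs_eq_cubeRadius {M : Type*} [Fintype M] (y : I^ M) (h : 0 < cubeRadius y) :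
    ∃ i, |2 * (y i : ℝ) - 1| = cubeRadius y := by
  by_contra! hne
  exact lt_irrefl _ ((pi_norm_lt_iff h).2 fun i => lt_of_le_of_ne (abs_le_cubeRadius y i) (hne i))

/-- The central projection from `(2, 0)` of the cylinder `[0,1] × [-1,1]^M` onto the union of its
bottom `{0} × [-1,1]^M` and its wall `[0,1] × ∂[-1,1]^M`, in the coordinates `2y - 1`. The
projection onto `[0,1]` only serves to land in the unit interval: the projected reals already
belong to it. -/
def cylinderRetraction {M : Type*} [Fintype M] (p : I × (I^ M)) : I × (I^ M) :=
  (Set.projIcc 0 1 zero_le_one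
      (2 - (2 - (p.1 : ℝ)) / max (1 - (p.1 : ℝ) / 2) (cubeRadius p.2)),
    fun i => Set.projIcc 0 1 zero_le_one
      (((2 * (p.2 i : ℝ) - 1) / max (1 - (p.1 : ℝ) / 2) (cubeRadius p.2) + 1) / 2))

theorem continuous_cylinderRetraction {M : Type*} [Fintype M] :
    Continuous (cylinderRetraction : I × (I^ M) → I × (I^ M)) := by
  have hr : Continuous fun p : I × (I^ M) => max (1 - (p.1 : ℝ) / 2) (cubeRadius p.2) :=
    Continuous.max (by fun_prop) (continuous_cubeRadius.comp continuous_snd)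
  have h0 : ∀ p : I × (I^ M), max (1 - (p.1 : ℝ) / 2) (cubeRadius p.2) ≠ 0 := fun p =>
    (lt_max_of_lt_left (by linarith [p.1.2.2])).ne'
  refine Continuous.prodMk (continuous_projIcc.comp ?_)
    (continuous_pi fun i => continuous_projIcc.comp ?_)
  · exact continuous_const.sub ((by fun_prop : Continuous fun p : I × (I^ M) => 2 - (p.1 : ℝ)).div
      hr h0)
  · exact (((by fun_prop : Continuous fun p : I × (I^ M) => 2 * (p.2 i : ℝ) - 1).div
      hr h0).add continuous_const).div_const 2

/-- The bottom and the wall of the cylinder `I × I^M`. -/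
def cylinderBottomWall (M : Type*) : Set (I × (I^ M)) :=
  {p | p.1 = 0 ∨ p.2 ∈ Cube.boundary M}

theorem cylinderRetraction_mem {M : Type*} [Fintype M] (p : I × (I^ M)) :
    cylinderRetraction p ∈ cylinderBottomWall M := by
  have ht : (0 : ℝ) < 1 - (p.1 : ℝ) / 2 := by linarith [p.1.2.2]
  rcases le_total (cubeRadius p.2) (1 - (p.1 : ℝ) / 2) with h | h
  · left
    refine Set.projIcc_of_le_left zero_le_one ?_
    rw [max_eq_left h, show 2 - (p.1 : ℝ) = 2 * (1 - (p.1 : ℝ) / 2) by ring,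
      mul_div_cancel_right₀ _ ht.ne']
    norm_num
  · right
    have hr := ht.trans_le h
    obtain ⟨i, hi⟩ := exists_abs_eq_cubeRadius p.2 hr
    refine ⟨i, ?_⟩
    rcases abs_eq hr.le |>.1 hi with h' | h'
    · right
      refine Set.projIcc_of_right_le zero_le_one ?_
      rw [max_eq_right h, h', div_self hr.ne']
      norm_num
    · left
      refine Set.projIcc_of_le_left zero_le_one ?_
      rw [max_eq_right h, h', neg_div, div_self hr.ne']
      norm_num

theorem cylinderRetraction_eq_self {M : Type*} [Fintype M] {p : I × (I^ M)}
    (hp : p ∈ cylinderBottomWall M) : cylinderRetraction p = p := by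
  have h1 : max (1 - (p.1 : ℝ) / 2) (cubeRadius p.2) = 1 := by
    rcases hp with h | h
    · rw [h]
      simpa using cubeRadius_le_one p.2
    · rw [cubeRadius_eq_one h]
      exact max_eq_right (by linarith [p.1.2.1])
  have key : ∀ (x : ℝ) (t : I), x = t → Set.projIcc 0 1 zero_le_one x = t := by
    rintro _ t rfl
    exact Set.projIcc_val _ t
  unfold cylinderRetraction
  rw [h1]
  exact Prod.ext (key _ _ (by ring)) (funext fun i => key _ _ (by ring))

theorem isClosed_cubeBoundary (M : Type*) [Finite M] : IsClosed (Cube.boundary M) := by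
  have : Cube.boundary M = ⋃ i, {y : I^ M | y i = 0 ∨ y i = 1} := by
    ext y
    simp [Cube.boundary]
  rw [this]
  exact isClosed_iUnion_of_finite fun i =>
    (isClosed_eq (continuous_apply i) continuous_const).union
      (isClosed_eq (continuous_apply i) continuous_const)

/-- Compatible maps on two closed sets which together cover the bottom and the wall of a cylinder
`I × I^M`, with parameters in `Z`, extend over the cylinder. -/
theorem exists_cylinder_extension {M Z X : Type*} [Fintype M] [TopologicalSpace Z]
    [TopologicalSpace X] {A B : Set ((I × (I^ M)) × Z)} (hA : IsClosed A) (hB : IsClosed B)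
    (hAB : ∀ p, p.1 ∈ cylinderBottomWall M → p ∈ A ∨ p ∈ B) {f g : (I × (I^ M)) × Z → X}
    (hf : ContinuousOn f A) (hg : ContinuousOn g B) (hfg : ∀ p ∈ A, p ∈ B → f p = g p) :
    ∃ G : C((I × (I^ M)) × Z, X), (∀ p ∈ A, p.1 ∈ cylinderBottomWall M → G p = f p) ∧
      ∀ p ∈ B, p.1 ∈ cylinderBottomWall M → G p = g p := by
  classical
  have hgB : ∀ p ∈ B, A.piecewise f g p = g p := by
    intro p hp
    by_cases h : p ∈ A
    · exact (Set.piecewise_eq_of_mem _ _ _ h).trans (hfg p h hp)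
    · exact Set.piecewise_eq_of_notMem _ _ _ h
  have hu : ContinuousOn (A.piecewise f g) (A ∪ B) :=
    ContinuousOn.union_of_isClosed (hf.congr fun p hp => Set.piecewise_eq_of_mem _ _ _ hp)
      (hg.congr hgB) hA hB
  have hr : Continuous fun p : (I × (I^ M)) × Z => (cylinderRetraction p.1, p.2) :=
    (continuous_cylinderRetraction.comp continuous_fst).prodMk continuous_snd
  have hself : ∀ p : (I × (I^ M)) × Z, p.1 ∈ cylinderBottomWall M →
      A.piecewise f g (cylinderRetraction p.1, p.2) = A.piecewise f g p := fun p hw =>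
    congrArg (A.piecewise f g) (Prod.ext (cylinderRetraction_eq_self hw) rfl)
  refine ⟨⟨fun p => A.piecewise f g (cylinderRetraction p.1, p.2),
    hu.comp_continuous hr fun p => hAB _ (cylinderRetraction_mem p.1)⟩, ?_, ?_⟩
  · exact fun p hp hw => (hself p hw).trans (Set.piecewise_eq_of_mem _ _ _ hp)
  · exact fun p hp hw => (hself p hw).trans (hgB p hp)

/-! ### Homotopy groups -/

/-- In a topological group, the pointwise inverse represents the inverse in the homotopy group:
for a loop `w` in `K`, the straight homotopy from the path `(1 - t, 1)` to the path `(0, t)` in the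
square carries, under `(a, b) ↦ w(a) w(b)⁻¹`, the reversed loop to the pointwise inverse; its
endpoints stay on the diagonal and at the corner `(0, 1)`. -/
theorem inv_mk_eq_mk_of_pointwise_inv {N : Type*} [DecidableEq N] [Nonempty N] {K : Type*}
    [Group K] [TopologicalSpace K] [IsTopologicalGroup K] (f g : Ω^ N K (1 : K))
    (hfg : ∀ y, g y = (f y)⁻¹) :
    (show HomotopyGroup N K 1 from Quotient.mk _ f)⁻¹ = Quotient.mk _ g := by
  let i : N := Classical.arbitrary N
  refine (HomotopyGroup.inv_spec (i := i)).trans (Quotient.sound ?_)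
  have hf : Continuous f := f.1.continuous
  have hup : ∀ (y : I^ N) (a : I), (∃ j, j ≠ i ∧ (y j = 0 ∨ y j = 1)) →
      f (Function.update y i a) = 1 := by
    rintro y a ⟨j, hj, h⟩
    exact f.2 _ ⟨j, by simpa [hj] using h⟩
  have hend : ∀ (y : I^ N) (a : I), a = 0 ∨ a = 1 → f (Function.update y i a) = 1 := by
    intro y a ha
    exact f.2 _ ⟨i, by simpa using ha⟩
  have hval : ∀ (u : I) (y : I^ N), y ∈ Cube.boundary N →
      f (Function.update y i (σ u * σ (y i))) *
        (f (Function.update y i (σ (u * σ (y i)))))⁻¹ = 1 := by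
    rintro u y ⟨j, hj⟩
    by_cases hji : j = i
    · subst hji
      rcases hj with h | h
      · simp [h]
      · rw [h]
        simp [hend]
    · rw [hup y _ ⟨j, hji, hj⟩, hup y _ ⟨j, hji, hj⟩]
      simp
  have hs : ∀ y, GenLoop.symmAt i f y = f (Function.update y i (σ (y i))) := by
    intro y
    change f _ = f _
    congr 1
    funext j
    by_cases h : j = i
    · subst h; simp
    · simp [h]
  refine ⟨⟨⟨⟨fun z => f (Function.update z.2 i (σ z.1 * σ (z.2 i))) *
    (f (Function.update z.2 i (σ (z.1 * σ (z.2 i)))))⁻¹, ?_⟩, ?_, ?_⟩, ?_⟩⟩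
  · have h1 : Continuous fun z : I × (I^ N) => σ z.1 * σ (z.2 i) := by fun_prop
    have h2 : Continuous fun z : I × (I^ N) => σ (z.1 * σ (z.2 i)) := by fun_prop
    exact (hf.comp (continuous_snd.update i h1)).mul (hf.comp (continuous_snd.update i h2)).inv
  · intro y
    refine Eq.trans ?_ (hs y).symm
    simp [hend]
  · intro y
    refine Eq.trans ?_ (hfg y).symm
    simp [hend]
  · intro t y hy
    exact (hval t y hy).trans ((GenLoop.symmAt i f).2 y hy).symm

theorem reindex_injective {M N : Type*} {X : Type*} [TopologicalSpace X] {x : X} (e : M ≃ N) :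
    Function.Injective (reindex (x := x) e) := by
  refine Function.LeftInverse.injective (g := reindex (x := x) e.symm) ?_
  rintro ⟨p⟩
  exact congrArg (Quotient.mk _) ((GenLoop.congr x e).symm_apply_apply p)

theorem adjunction_injective (M N : Type*) {X : Type*} [TopologicalSpace X] (x : X) :
    Function.Injective (adjunction M N x) := by
  rintro ⟨p⟩ ⟨q⟩ h
  obtain ⟨H⟩ : GenLoop.Homotopic (GenLoop.genLoopGenLoopEquiv x p)
      (GenLoop.genLoopGenLoopEquiv x q) := Quotient.exact h
  have hc : Continuous fun z : (I × (I^ M)) × (I^ N) => H (z.1.1, Sum.elim z.1.2 z.2) := by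
    refine H.continuous.comp (Continuous.prodMk (by fun_prop) (continuous_pi ?_))
    rintro (i | j) <;> dsimp <;> fun_prop
  have hb : ∀ z : I × (I^ M), (⟨_, hc⟩ : C((I × (I^ M)) × (I^ N), X)).curry z ∈ Ω^ N X x := by
    intro z y hy
    have hy' : Sum.elim z.2 y ∈ Cube.boundary (M ⊕ N) := Cube.boundary_sum_iff.2 (Or.inr hy)
    exact (H.eq_fst z.1 hy').trans ((GenLoop.genLoopGenLoopEquiv x p).2 _ hy')
  refine Quotient.sound ⟨⟨⟨⟨fun z => ⟨_, hb z⟩,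
    Continuous.subtype_mk (ContinuousMap.continuous _) _⟩, ?_, ?_⟩, ?_⟩⟩
  · intro y
    refine GenLoop.ext _ _ fun t => ?_
    exact H.apply_zero _
  · intro y
    refine GenLoop.ext _ _ fun t => ?_
    exact H.apply_one _
  · intro t y hy
    refine GenLoop.ext _ _ fun s => ?_
    exact H.eq_fst t (Cube.boundary_sum_iff.2 (Or.inl hy))

theorem inducedMap_injective {N : Type*} {X Y : Type*} [TopologicalSpace X] [TopologicalSpace Y]
    {x : X} {y : Y} (f : C(X, Y)) (hf : f x = y) (h : IsHomeomorph f) :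
    Function.Injective (inducedMap N f hf) := by
  obtain ⟨e, he⟩ := isHomeomorph_iff_exists_homeomorph.1 h
  have hx : e.symm y = x := by
    rw [← hf, ← he]
    exact e.symm_apply_apply x
  refine Function.LeftInverse.injective
    (g := inducedMap N (⟨e.symm, e.symm.continuous⟩ : C(Y, X)) hx) ?_
  rintro ⟨p⟩
  refine congrArg (Quotient.mk _) (GenLoop.ext _ _ fun t => ?_)
  change e.symm (f (p t)) = p t
  rw [← he]
  exact e.symm_apply_apply _

/-! ### Gauge maps of a bundle described on the cube -/

namespace IsPrincipalBundle

variable {K : Type*} [Group K] [TopologicalSpace K] {P B : Type*} [TopologicalSpace P]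
  [TopologicalSpace B] [MulAction Kᵐᵒᵖ P] {η : P → B}

theorem continuous_proj (hη : IsPrincipalBundle K η) : Continuous η := by
  refine continuous_iff_continuousAt.2 fun p => ?_
  obtain ⟨e, he, -⟩ := hη.locally_trivial (η p)
  exact e.continuousAt_proj (e.mem_source.2 he)

theorem act_injective (hη : IsPrincipalBundle K η) (p : P) :
    Function.Injective fun k : K => MulOpposite.op k • p := by
  intro k k' h
  obtain ⟨e, he, hact⟩ := hη.locally_trivial (η p)
  have h' := congrArg (fun x => (e x).2) h
  simpa only [hact p he, mul_right_inj] using h'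

theorem exists_act_eq (hη : IsPrincipalBundle K η) {p p' : P} (h : η p = η p') :
    ∃ k : K, MulOpposite.op k • p = p' := by
  obtain ⟨e, he, hact⟩ := hη.locally_trivial (η p)
  refine ⟨(e p).2⁻¹ * (e p').2, e.injOn ?_ ?_ ?_⟩
  · rwa [e.mem_source, hη.proj_act]
  · rwa [e.mem_source, ← h]
  · have h1 : (e p).1 = η p := e.coe_fst' he
    have h2 : (e p').1 = η p' := e.coe_fst' (h ▸ he)
    exact (hact p he _).trans (Prod.ext (h1.trans (h.trans h2.symm)) (mul_inv_cancel_left _ _))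

end IsPrincipalBundle

namespace CharacteristicMap

variable {K : Type*} [Group K] [TopologicalSpace K] {P : Type*}
  [TopologicalSpace P] [MulAction Kᵐᵒᵖ P] {m : ℕ} {η : P → Sph (m + 1)}

/-- The parametrization `(x, k) ↦ sec(x) · k` of the total space. -/
def param (c : CharacteristicMap K η) (z : (I^ (Fin (m + 1))) × K) : P :=
  MulOpposite.op z.2 • c.sec z.1

theorem clutch_cubeBase (hη : IsPrincipalBundle K η) (c : CharacteristicMap K η) :
    c.clutch ⟨cubeBase m, cubeBase_mem m⟩ = 1 := by
  apply hη.act_injective (c.sec (cubeBase m))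
  simpa using c.sec_act_clutch ⟨cubeBase m, cubeBase_mem m⟩

theorem param_surjective (hη : IsPrincipalBundle K η) (c : CharacteristicMap K η) :
    Function.Surjective c.param := by
  intro p
  obtain ⟨x, hx⟩ := c.q_surjective (η p)
  obtain ⟨k, hk⟩ := hη.exists_act_eq ((c.proj_sec x).trans hx)
  exact ⟨(x, k), hk⟩

/-- The parametrization of the total space is universally closed, because the cube is compact:
if `sec(x) · k` converges along an ultrafilter, then so does `x`, and hence, in a local
trivialization, `k`. -/
theorem isProperMap_param [IsTopologicalGroup K] (hη : IsPrincipalBundle K η)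
    (c : CharacteristicMap K η) : IsProperMap c.param := by
  have hcont : Continuous c.param :=
    hη.continuous_act.comp ((c.sec.continuous.comp continuous_fst).prodMk continuous_snd)
  refine isProperMap_iff_ultrafilter.2 ⟨hcont, fun U p hU => ?_⟩
  obtain ⟨x, -, hx⟩ := isCompact_univ.ultrafilter_le_nhds (U.map Prod.fst) (by simp)
  have hx' : Filter.Tendsto Prod.fst (U : Filter ((I^ (Fin (m + 1))) × K)) (𝓝 x) := hx
  have hsec : Filter.Tendsto (fun z : (I^ (Fin (m + 1))) × K => c.sec z.1) U (𝓝 (c.sec x)) :=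
    (c.sec.continuous.tendsto x).comp hx'
  have hη' : ∀ z, η (c.param z) = η (c.sec z.1) := fun z => hη.proj_act _ _
  have hbase : η (c.sec x) = η p := by
    refine tendsto_nhds_unique ((hη.continuous_proj.tendsto _).comp hsec) ?_
    exact ((hη.continuous_proj.tendsto p).comp hU).congr hη'
  obtain ⟨e, he, hact⟩ := hη.locally_trivial (η p)
  have hex : η (c.sec x) ∈ e.baseSet := hbase ▸ he
  have h1 : Filter.Tendsto (fun z : (I^ (Fin (m + 1))) × K => (e (c.sec z.1)).2) U
      (𝓝 (e (c.sec x)).2) :=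
    (continuous_snd.tendsto _).comp
      ((e.continuousAt (e.mem_source.2 hex)).tendsto.comp hsec)
  have h2 : Filter.Tendsto (fun z : (I^ (Fin (m + 1))) × K => (e (c.param z)).2) U
      (𝓝 (e p).2) :=
    (continuous_snd.tendsto _).comp ((e.continuousAt (e.mem_source.2 he)).tendsto.comp hU)
  have hev : ∀ᶠ z in (U : Filter ((I^ (Fin (m + 1))) × K)), η (c.sec z.1) ∈ e.baseSet :=
    ((hη.continuous_proj.tendsto _).comp hsec).eventually (e.open_baseSet.mem_nhds hex)
  have h3 : Filter.Tendsto Prod.snd (U : Filter ((I^ (Fin (m + 1))) × K))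
      (𝓝 ((e (c.sec x)).2⁻¹ * (e p).2)) := by
    refine (h1.inv.mul h2).congr' ?_
    filter_upwards [hev] with z hz
    simp [param, hact _ hz]
  refine ⟨(x, (e (c.sec x)).2⁻¹ * (e p).2), e.injOn ?_ (e.mem_source.2 he) ?_, ?_⟩
  · rw [e.mem_source, hη']
    exact hex
  · have e1 : (e (c.sec x)).1 = η (c.sec x) := e.coe_fst' hex
    have e2 : (e p).1 = η p := e.coe_fst' he
    exact (hact _ hex _).trans (Prod.ext (e1.trans (hbase.trans e2.symm)) (mul_inv_cancel_left _ _))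
  · exact (Filter.tendsto_id'.1 ((hx'.prodMk_nhds h3) : Filter.Tendsto id _ _))

theorem param_eq_param (hη : IsPrincipalBundle K η) (c : CharacteristicMap K η)
    {x x' : I^ (Fin (m + 1))} {k k' : K} (h : c.param (x, k) = c.param (x', k')) :
    (x = x' ∧ k = k') ∨ ∃ (hx : x ∈ Cube.boundary _) (hx' : x' ∈ Cube.boundary _),
      (c.clutch ⟨x, hx⟩)⁻¹ * k = (c.clutch ⟨x', hx'⟩)⁻¹ * k' := by
  have hq : c.q x = c.q x' := by
    rw [← c.proj_sec, ← c.proj_sec, ← hη.proj_act _ k, ← hη.proj_act (c.sec x') k']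
    exact congrArg η h
  rcases (c.q_eq_iff x x').1 hq with rfl | ⟨hx, hx'⟩
  · exact Or.inl ⟨rfl, hη.act_injective _ h⟩
  · refine Or.inr ⟨hx, hx', hη.act_injective (c.sec (cubeBase m)) ?_⟩
    have key : ∀ (y : Cube.boundary (Fin (m + 1))) (l : K),
        MulOpposite.op ((c.clutch y)⁻¹ * l) • c.sec (cubeBase m) = c.param (y, l) := by
      intro y l
      rw [← c.sec_act_clutch y, smul_smul, ← MulOpposite.op_mul, mul_inv_cancel_left]
      rfl
    exact (key ⟨x, hx⟩ k).trans (h.trans (key ⟨x', hx'⟩ k').symm)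

variable [IsTopologicalGroup K]

theorem gauge_apply_param (c : CharacteristicMap K η) (f : gaugeGroup K P)
    (z : (I^ (Fin (m + 1))) × K) : f.1 (c.param z) = z.2⁻¹ * f.1 (c.sec z.1) * z.2 :=
  f.2 _ _

/-- On the boundary of the cube, a gauge map is the conjugate of its value at the base point by the
clutching function. -/
theorem gauge_apply_sec_boundary (c : CharacteristicMap K η) (f : gaugeGroup K P)
    (y : Cube.boundary (Fin (m + 1))) :
    f.1 (c.sec y) = c.clutch y * f.1 (c.sec (cubeBase m)) * (c.clutch y)⁻¹ := by
  rw [← c.sec_act_clutch y, f.2 (c.sec y) (c.clutch y)]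
  group

theorem gauge_ext (hη : IsPrincipalBundle K η) (c : CharacteristicMap K η)
    {f g : gaugeGroup K P} (h : ∀ x, f.1 (c.sec x) = g.1 (c.sec x)) : f = g := by
  refine Subtype.ext (ContinuousMap.ext fun p => ?_)
  obtain ⟨z, rfl⟩ := c.param_surjective hη p
  rw [gauge_apply_param, gauge_apply_param, h]

theorem continuous_gauge_apply_sec (c : CharacteristicMap K η) {Z : Type*} [TopologicalSpace Z]
    (F : C(Z, gaugeGroup K P)) :
    Continuous fun z : Z × (I^ (Fin (m + 1))) => (F z.1).1 (c.sec z.2) := by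
  have h : Continuous fun z : Z => (F z).1.comp c.sec :=
    (ContinuousMap.continuous_precomp c.sec).comp (continuous_subtype_val.comp F.continuous)
  exact ContinuousMap.continuous_uncurry_of_continuous ⟨_, h⟩

/-- A continuous family of maps on the cube, each of which satisfies the boundary condition of a
gauge map, comes from a continuous family of gauge maps: the function
`(z, x, k) ↦ k⁻¹ G(z, x) k` descends along the proper surjection `id × param`, which is a quotient
map. -/
theorem exists_gauge_family (hη : IsPrincipalBundle K η) (c : CharacteristicMap K η) {Z : Type*}
    [TopologicalSpace Z] (G : C(Z × (I^ (Fin (m + 1))), K))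
    (hG : ∀ (z : Z) (y : Cube.boundary (Fin (m + 1))),
      G (z, y) = c.clutch y * G (z, cubeBase m) * (c.clutch y)⁻¹) :
    ∃ F : C(Z, gaugeGroup K P), ∀ z x, (F z).1 (c.sec x) = G (z, x) := by
  have hs : Function.Surjective (Prod.map id c.param : Z × ((I^ (Fin (m + 1))) × K) → Z × P) :=
    Function.surjective_id.prodMap (c.param_surjective hη)
  have hp : IsProperMap (Prod.map id c.param : Z × ((I^ (Fin (m + 1))) × K) → Z × P) :=
    isProperMap_id.prodMap (c.isProperMap_param hη)
  have hquot := hp.isClosedMap.isQuotientMap hp.continuous hs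
  let g : C(Z × ((I^ (Fin (m + 1))) × K), K) :=
    ⟨fun z => z.2.2⁻¹ * G (z.1, z.2.1) * z.2.2, by fun_prop⟩
  have hg : Function.FactorsThrough g
      (Prod.map id c.param : Z × ((I^ (Fin (m + 1))) × K) → Z × P) := by
    rintro ⟨z, x, k⟩ ⟨z', x', k'⟩ h
    obtain ⟨h1, h2⟩ := Prod.ext_iff.1 h
    obtain rfl : z = z' := h1
    change k⁻¹ * G (z, x) * k = k'⁻¹ * G (z, x') * k'
    rcases c.param_eq_param hη h2 with ⟨rfl, rfl⟩ | ⟨hx, hx', hk⟩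
    · rfl
    · have e1 := hG z ⟨x, hx⟩
      have e2 := hG z ⟨x', hx'⟩
      dsimp only at e1 e2
      rw [e1, e2]
      calc _ = ((c.clutch ⟨x, hx⟩)⁻¹ * k)⁻¹ * G (z, cubeBase m) *
            ((c.clutch ⟨x, hx⟩)⁻¹ * k) := by group
        _ = _ := by rw [hk]; group
  let h : C(Z × P, K) := hquot.lift (f := ⟨_, hp.continuous⟩) g hg
  have hh : ∀ z x k, h (z, c.param (x, k)) = k⁻¹ * G (z, x) * k := fun z x k =>
    congrArg (fun φ : C(Z × ((I^ (Fin (m + 1))) × K), K) => φ (z, x, k))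
      (hquot.lift_comp (f := ⟨_, hp.continuous⟩) g hg)
  have hmem : ∀ z, h.curry z ∈ gaugeGroup K P := by
    intro z p k
    obtain ⟨⟨x, l⟩, rfl⟩ := c.param_surjective hη p
    have hact : MulOpposite.op k • c.param (x, l) = c.param (x, l * k) := by
      simp [param, smul_smul]
    simp only [ContinuousMap.curry_apply, hact, hh]
    group
  refine ⟨⟨fun z => ⟨h.curry z, hmem z⟩, h.curry.continuous.subtype_mk hmem⟩, fun z x => ?_⟩
  have h1 := hh z x 1
  simpa [param] using h1

/-- The inverse of the comparison map comes from the tautological family on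
`C_*(I^{m+1}/∂I^{m+1}, K)`. -/
theorem isHomeomorph_fibreMap (hη : IsPrincipalBundle K η) (c : CharacteristicMap K η) :
    IsHomeomorph c.fibreMap := by
  let Z := Ω^ (Fin (m + 1)) K (1 : K)
  have hcont : Continuous fun z : Z × (I^ (Fin (m + 1))) => z.1 z.2 := by fun_prop
  obtain ⟨F, hF⟩ := c.exists_gauge_family hη ⟨_, hcont⟩ (by
    intro z y
    have h1 : z y = 1 := z.2 y y.2
    have h2 : z (cubeBase m) = 1 := z.2 _ (cubeBase_mem m)
    simp [h1, h2])
  have hF1 : ∀ z, F z ∈ evaluation K (c.sec (cubeBase m)) ⁻¹' {1} := fun z =>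
    (hF z (cubeBase m)).trans (z.2 _ (cubeBase_mem m))
  refine isHomeomorph_iff_exists_inverse.2 ⟨c.fibreMap.continuous, fun z => ⟨F z, hF1 z⟩, ?_, ?_,
    F.continuous.subtype_mk _⟩
  · intro f
    exact Subtype.ext (c.gauge_ext hη fun x => hF _ x)
  · intro z
    exact GenLoop.ext _ _ fun x => hF z x

theorem fibreIdentification_injective (hη : IsPrincipalBundle K η) (c : CharacteristicMap K η)
    (n : ℕ) : Function.Injective (c.fibreIdentification n) :=
  (reindex_injective _).comp ((adjunction_injective _ _ _).comp
    (inducedMap_injective _ _ (c.isHomeomorph_fibreMap hη)))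

end CharacteristicMap

/-! ### The homotopy lifting property and lifts of loops -/

/-- A map defined for `y` in a subset `S` of `Y`, as a function on all of `Y` (arbitrary off `S`). -/
theorem exists_continuousOn_extension {X Y V : Type*} [TopologicalSpace X] [TopologicalSpace Y]
    [TopologicalSpace V] [Nonempty V] {S : Set Y} (f : C(X × S, V)) :
    ∃ g : X × Y → V, ContinuousOn g {p | p.2 ∈ S} ∧ ∀ (x : X) (y : S), g (x, y) = f (x, y) := by
  classical
  refine ⟨fun p => if h : p.2 ∈ S then f (p.1, ⟨p.2, h⟩) else Classical.arbitrary V, ?_, ?_⟩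
  · rw [continuousOn_iff_continuous_domRestrict]
    have h : Continuous fun p : {p : X × Y | p.2 ∈ S} => f (p.1.1, ⟨p.1.2, p.2⟩) := by fun_prop
    refine h.congr fun p => ?_
    have hp : p.1.2 ∈ S := p.2
    simp [Set.domRestrict, hp]
  · intro x y
    exact dif_pos y.2

namespace CharacteristicMap

variable {K : Type*} [Group K] [TopologicalSpace K] [IsTopologicalGroup K] {P : Type*}
  [TopologicalSpace P] [MulAction Kᵐᵒᵖ P] {m : ℕ} {η : P → Sph (m + 1)}

/-- A lift of a homotopy of values at the base point is a map on `I × I^{m+1}`, prescribed on the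
bottom by the initial gauge maps and on the wall by conjugation with the clutching function. -/
theorem isSerreFibration_evaluation (hη : IsPrincipalBundle K η) (c : CharacteristicMap K η) :
    IsSerreFibration (evaluation K (c.sec (cubeBase m))) := by
  intro k H f hf
  obtain ⟨γ, hγc, hγ⟩ := exists_continuousOn_extension
    (c.clutch.comp (ContinuousMap.snd : C(I × Cube.boundary (Fin (m + 1)), _)))
  have hγc' : ContinuousOn (fun p : (I × (I^ (Fin (m + 1)))) × (I^ (Fin k)) => γ p.1)
      {p | p.1.2 ∈ Cube.boundary _} :=
    hγc.comp continuousOn_fst fun p hp => hp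
  have hH : Continuous fun p : (I × (I^ (Fin (m + 1)))) × (I^ (Fin k)) => H (p.2, p.1.1) := by
    fun_prop
  have hg : Continuous fun p : (I × (I^ (Fin (m + 1)))) × (I^ (Fin k)) =>
      (f p.2).1 (c.sec p.1.2) :=
    (c.continuous_gauge_apply_sec f).comp
      (by fun_prop : Continuous fun p : (I × (I^ (Fin (m + 1)))) × (I^ (Fin k)) => (p.2, p.1.2))
  obtain ⟨G, hGA, hGB⟩ := exists_cylinder_extension
    (A := {p : (I × (I^ (Fin (m + 1)))) × (I^ (Fin k)) | p.1.2 ∈ Cube.boundary _})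
    (B := {p | p.1.1 = 0}) (f := fun p => γ p.1 * H (p.2, p.1.1) * (γ p.1)⁻¹)
    ((isClosed_cubeBoundary _).preimage (by fun_prop))
    (isClosed_eq (by fun_prop) continuous_const) (fun p hp => hp.symm)
    ((hγc'.mul hH.continuousOn).mul hγc'.inv) hg.continuousOn (by
      rintro ⟨⟨t, y⟩, x⟩ hy ht
      obtain rfl : t = 0 := ht
      have h1 := c.gauge_apply_sec_boundary (f x) ⟨y, hy⟩
      have h2 : γ (0, y) = c.clutch ⟨y, hy⟩ := hγ 0 ⟨y, hy⟩
      have h3 : (f x).1 (c.sec (cubeBase m)) = H (x, 0) := hf x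
      simp only [h2]
      rw [← h3]
      exact h1.symm)
  have hGw : ∀ (x : I^ (Fin k)) (t : I) (y : Cube.boundary (Fin (m + 1))),
      G ((t, y), x) = c.clutch y * H (x, t) * (c.clutch y)⁻¹ := by
    intro x t y
    have h2 : γ (t, y) = c.clutch y := hγ t y
    rw [hGA ((t, y), x) y.2 (Or.inr y.2)]
    simp only [h2]
  have hGb : ∀ (x : I^ (Fin k)) (t : I), G ((t, cubeBase m), x) = H (x, t) := by
    intro x t
    rw [hGw x t ⟨cubeBase m, cubeBase_mem m⟩, c.clutch_cubeBase hη]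
    simp
  obtain ⟨F, hF⟩ := c.exists_gauge_family hη
    (G.comp ⟨fun z : ((I^ (Fin k)) × I) × (I^ (Fin (m + 1))) => ((z.1.2, z.2), z.1.1),
      by fun_prop⟩) (by
    rintro ⟨x, t⟩ y
    simp only [ContinuousMap.comp_apply, ContinuousMap.coe_mk, hGw, hGb])
  refine ⟨F, fun x => c.gauge_ext hη fun y => ?_, fun z => ?_⟩
  · exact (hF _ _).trans (hGB ((0, y), x) rfl (Or.inl rfl))
  · exact (hF z _).trans (hGb z.1 z.2)

/-- The lift is a map on `I × I^{n+m+1}`, the first coordinate being the reversed last coordinate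
of the `(n+1)`-cube on which the loop is defined; it is prescribed on the bottom and on the wall. -/
theorem exists_isLift (hη : IsPrincipalBundle K η) (c : CharacteristicMap K η) {n : ℕ}
    (α : Ω^ (Fin (n + 1)) K (1 : K)) :
    ∃ F, IsLift (evaluation K (c.sec (cubeBase m))) 1 α F := by
  obtain ⟨γ, hγc, hγ⟩ := exists_continuousOn_extension
    (c.clutch.comp (ContinuousMap.snd : C(I × Cube.boundary (Fin (m + 1)), _)))
  let Q := (I × (I^ (Fin n ⊕ Fin (m + 1)))) × Unit
  let xc : Q → I^ (Fin (n + 1)) := fun p => Fin.snoc (fun i => p.1.2 (Sum.inl i)) (σ p.1.1)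
  let yc : Q → I^ (Fin (m + 1)) := fun p j => p.1.2 (Sum.inr j)
  have hxc : Continuous xc := by fun_prop
  have hyc : Continuous yc := by fun_prop
  have hα : Continuous fun p => α (xc p) := α.1.continuous.comp hxc
  have hγc' : ContinuousOn (fun p : Q => γ (p.1.1, yc p)) {p | yc p ∈ Cube.boundary _} :=
    hγc.comp (by fun_prop : Continuous fun p : Q => (p.1.1, yc p)).continuousOn fun p hp => hp
  have hα1 : ∀ p, p.1.1 = 0 ∨ (fun i => p.1.2 (Sum.inl i)) ∈ Cube.boundary (Fin n) →
      α (xc p) = 1 := by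
    rintro p (h | ⟨i, hi⟩)
    · exact α.2 _ ⟨Fin.last n, Or.inr (by simp [xc, h])⟩
    · exact α.2 _ ⟨i.castSucc, by simpa [xc] using hi⟩
  obtain ⟨G, hGA, hGB⟩ := exists_cylinder_extension
    (A := {p : Q | yc p ∈ Cube.boundary _})
    (B := {p : Q | p.1.1 = 0 ∨ (fun i => p.1.2 (Sum.inl i)) ∈ Cube.boundary (Fin n)})
    (f := fun p => γ (p.1.1, yc p) * α (xc p) * (γ (p.1.1, yc p))⁻¹) (g := fun _ => 1)
    ((isClosed_cubeBoundary _).preimage hyc)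
    ((isClosed_eq (by fun_prop) continuous_const).union
      ((isClosed_cubeBoundary _).preimage (by fun_prop)))
    (by
      rintro p (h | h)
      · exact Or.inr (Or.inl h)
      · exact (Cube.boundary_sum_iff.1 h).elim (fun h => Or.inr (Or.inr h)) Or.inl)
    ((hγc'.mul hα.continuousOn).mul hγc'.inv) continuousOn_const (by
      intro p _ hp
      simp [hα1 p hp])
  let j : (I^ (Fin (n + 1))) × (I^ (Fin (m + 1))) → Q := fun z =>
    ((σ (z.1 (Fin.last n)), Sum.elim (Fin.init z.1) z.2), ())
  have hj : Continuous j := by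
    refine Continuous.prodMk (Continuous.prodMk (by fun_prop) (continuous_pi ?_)) continuous_const
    rintro (i | i) <;> dsimp [Fin.init] <;> fun_prop
  have hjx : ∀ z, xc (j z) = z.1 := by
    intro z
    have : σ (σ (z.1 (Fin.last n))) = z.1 (Fin.last n) := unitInterval.symm_symm _
    simp only [xc, j, this, Sum.elim_inl]
    exact Fin.snoc_init_self z.1
  have hGw : ∀ (x : I^ (Fin (n + 1))) (y : Cube.boundary (Fin (m + 1))),
      G (j (x, y)) = c.clutch y * α x * (c.clutch y)⁻¹ := by
    intro x y
    have h2 : γ ((j (x, y)).1.1, y.1) = c.clutch y := hγ _ y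
    rw [hGA (j (x, y)) y.2 (Or.inr (Cube.boundary_sum_iff.2 (Or.inr y.2)))]
    simp only [hjx]
    exact congrArg (fun g => g * α x * g⁻¹) h2
  have hGb : ∀ x : I^ (Fin (n + 1)), G (j (x, cubeBase m)) = α x := by
    intro x
    rw [hGw x ⟨cubeBase m, cubeBase_mem m⟩, c.clutch_cubeBase hη]
    simp
  obtain ⟨F, hF⟩ := c.exists_gauge_family hη (G.comp ⟨j, hj⟩) (by
    intro x y
    simp only [ContinuousMap.comp_apply, ContinuousMap.coe_mk, hGw, hGb])
  refine ⟨F, fun x => (hF x _).trans (hGb x), fun x hx => c.gauge_ext hη fun y => ?_,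
    fun x hx => c.gauge_ext hη fun y => ?_⟩
  · have h0 : (j (x, y)).1.1 = 0 := by simp [j, hx]
    exact (hF x y).trans (hGB _ (Or.inl h0) (Or.inl h0))
  · have h0 : Fin.init x ∈ Cube.boundary (Fin n) := hx
    exact (hF x y).trans (hGB (j (x, y)) (Or.inr h0)
      (Or.inr (Cube.boundary_sum_iff.2 (Or.inl h0))))

end CharacteristicMap

/-! ### The connecting map and the Samelson product -/

/-- A loop `g(t, z)` and a loop `h(s, z)` that are the two edges `s = 0` and `t = 0` of a map on
the square with parameters `z` which is trivial on the other two edges and for `z` in the boundary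
are homotopic. Here `t` for `g`, and `s` for `h`, is the coordinate `i` of the cube, and `z` consists
of the other coordinates; the parameter of `q` is allowed to be the whole point of the cube, so that
no coordinate has to be removed. The homotopy runs through the broken paths
`t ↦ (min(1, 2u) t, min(1, 2 - 2u) t)` of the square, which start at the common vertex of the two
edges and end on one of the trivial edges. -/
theorem homotopic_of_square {N X : Type*} [TopologicalSpace X] {x : X} (i : N)
    (q : C((I × I) × (I^ N), X)) (g h : Ω^ N X x)
    (hg : ∀ w, g w = q ((0, w i), w)) (hh : ∀ w, h w = q ((w i, 0), w))
    (h0 : ∀ w, q ((0, 0), w) = x) (h1 : ∀ t w, q ((1, t), w) = x) (h2 : ∀ s w, q ((s, 1), w) = x)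
    (hw : ∀ s t w, (∃ j, j ≠ i ∧ (w j = 0 ∨ w j = 1)) → q ((s, t), w) = x) :
    GenLoop.Homotopic g h := by
  let a : I → I := fun u => Set.projIcc 0 1 zero_le_one (2 * (u : ℝ))
  have ha : Continuous a := continuous_projIcc.comp (by fun_prop)
  have a0 : a 0 = 0 := Set.projIcc_of_le_left zero_le_one (by simp)
  have a1 : ∀ u : I, 1 / 2 ≤ (u : ℝ) → a u = 1 := fun u hu =>
    Set.projIcc_of_right_le zero_le_one (by linarith)
  have a1' : a 1 = 1 := a1 1 (by norm_num)
  refine ⟨⟨⟨⟨fun z => q ((a z.1 * z.2 i, a (σ z.1) * z.2 i), z.2), by fun_prop⟩, ?_, ?_⟩, ?_⟩⟩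
  · intro w
    refine Eq.trans ?_ (hg w).symm
    simp [a0, a1']
  · intro w
    refine Eq.trans ?_ (hh w).symm
    simp [a0, a1']
  · rintro u w hwb
    refine Eq.trans ?_ (g.2 w hwb).symm
    change q ((a u * w i, a (σ u) * w i), w) = x
    obtain ⟨j, hj⟩ := hwb
    by_cases hji : j = i
    · subst hji
      rcases hj with hj | hj
      · simp [hj, h0]
      · rcases le_total (1 / 2 : ℝ) u with hu | hu
        · simp [hj, a1 u hu, h1]
        · have hu' : a (σ u) = 1 := a1 _ (by rw [unitInterval.coe_symm_eq]; linarith)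
          simp [hj, hu', h2]
    · exact hw _ _ _ ⟨j, hji, hj⟩

namespace CharacteristicMap

variable {K : Type*} [Group K] [TopologicalSpace K] [IsTopologicalGroup K] {P : Type*}
  [TopologicalSpace P] [MulAction Kᵐᵒᵖ P] {m : ℕ} {η : P → Sph (m + 1)}

/-- A lift of `α`, regarded as a map on `I^{n+1} × I^{m+1}`, can be deformed so that its values for
`y ∈ ∂I^{m+1}` become the conjugates of `α` by any map homotopic to the clutching function, without
changing its values for `x ∈ ∂I^{n+1}`. -/
theorem exists_deformed_lift (c : CharacteristicMap K η) {n : ℕ} {α : Ω^ (Fin (n + 1)) K (1 : K)}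
    {F : C(I^ (Fin (n + 1)), gaugeGroup K P)}
    (hF : IsLift (evaluation K (c.sec (cubeBase m))) 1 α F)
    {γ : C(Cube.boundary (Fin (m + 1)), K)} (hγ : c.clutch.Homotopic γ) :
    ∃ G : C((I^ (Fin (n + 1))) × (I^ (Fin (m + 1))), K),
      (∀ x ∈ Cube.boundary (Fin (n + 1)), ∀ y, G (x, y) = (F x).1 (c.sec y)) ∧
      ∀ (x : I^ (Fin (n + 1))) (y : Cube.boundary (Fin (m + 1))),
        G (x, y) = γ y * α x * (γ y)⁻¹ := by
  obtain ⟨H⟩ := hγ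
  obtain ⟨Γ, hΓc, hΓ⟩ := exists_continuousOn_extension H.toContinuousMap
  have hΓ0 : ∀ y : Cube.boundary (Fin (m + 1)), Γ (0, y) = c.clutch y := fun y =>
    (hΓ 0 y).trans (H.apply_zero y)
  have hΓ1 : ∀ y : Cube.boundary (Fin (m + 1)), Γ (1, y) = γ y := fun y =>
    (hΓ 1 y).trans (H.apply_one y)
  let Q := (I × (I^ (Fin (n + 1) ⊕ Fin (m + 1)))) × Unit
  let xc : Q → I^ (Fin (n + 1)) := fun p i => p.1.2 (Sum.inl i)
  let yc : Q → I^ (Fin (m + 1)) := fun p j => p.1.2 (Sum.inr j)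
  have hxc : Continuous xc := by fun_prop
  have hyc : Continuous yc := by fun_prop
  have hα : Continuous fun p => α (xc p) := α.1.continuous.comp hxc
  have hΓc' : ContinuousOn (fun p : Q => Γ (p.1.1, yc p)) {p | yc p ∈ Cube.boundary _} :=
    hΓc.comp (by fun_prop : Continuous fun p : Q => (p.1.1, yc p)).continuousOn fun p hp => hp
  have hFy : ∀ x (y : Cube.boundary (Fin (m + 1))),
      (F x).1 (c.sec y) = c.clutch y * α x * (c.clutch y)⁻¹ := fun x y => by
    rw [c.gauge_apply_sec_boundary, ← hF.proj x]
    rfl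
  obtain ⟨G, hGA, hGB⟩ := exists_cylinder_extension
    (A := {p : Q | yc p ∈ Cube.boundary _})
    (B := {p : Q | p.1.1 = 0 ∨ xc p ∈ Cube.boundary _})
    (f := fun p => Γ (p.1.1, yc p) * α (xc p) * (Γ (p.1.1, yc p))⁻¹)
    (g := fun p => (F (xc p)).1 (c.sec (yc p)))
    ((isClosed_cubeBoundary _).preimage hyc)
    ((isClosed_eq (by fun_prop) continuous_const).union ((isClosed_cubeBoundary _).preimage hxc))
    (by
      rintro p (h | h)
      · exact Or.inr (Or.inl h)
      · exact (Cube.boundary_sum_iff.1 h).elim (fun h => Or.inr (Or.inr h)) Or.inl)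
    ((hΓc'.mul hα.continuousOn).mul hΓc'.inv)
    ((c.continuous_gauge_apply_sec F).comp (hxc.prodMk hyc)).continuousOn (by
      intro p hy hp
      have h1 := hFy (xc p) ⟨yc p, hy⟩
      dsimp only at h1 ⊢
      rcases hp with hp | hp
      · have h2 : Γ (0, yc p) = _ := hΓ0 ⟨yc p, hy⟩
        rw [h1, hp, h2]
      · have h2 : α (xc p) = 1 := α.2 _ hp
        rw [h1, h2]
        simp)
  let j : (I^ (Fin (n + 1))) × (I^ (Fin (m + 1))) → Q := fun z => ((1, Sum.elim z.1 z.2), ())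
  have hj : Continuous j := by
    refine Continuous.prodMk (Continuous.prodMk (by fun_prop) (continuous_pi ?_)) continuous_const
    rintro (i | i) <;> dsimp <;> fun_prop
  refine ⟨G.comp ⟨j, hj⟩, fun x hx y => ?_, fun x y => ?_⟩
  · exact hGB (j (x, y)) (Or.inr hx) (Or.inr (Cube.boundary_sum_iff.2 (Or.inl hx)))
  · exact (hGA (j (x, y)) y.2 (Or.inr (Cube.boundary_sum_iff.2 (Or.inr y.2)))).trans
      (congrArg (fun k => k * α x * k⁻¹) (hΓ1 y))

/-- The restriction of any lift of `α` to the bottom face represents the inverse of the Samelson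
product. For the deformed lift `G`, the map `G(x, y) α(x)⁻¹` is trivial on all faces of
`I^{n+1} × I^{m+1}` but two: on the face where the last coordinate of `x` is `0` it is the
restriction of the lift, and on the face where the first coordinate of `y` is `0` it is the
pointwise inverse of the commutator map. -/
theorem fibreIdentification_bottom (c : CharacteristicMap K η) {n : ℕ} {b : π_ m K (1 : K)}
    (hb : c.Represents b) (α : Ω^ (Fin (n + 1)) K (1 : K))
    {F : C(I^ (Fin (n + 1)), gaugeGroup K P)}
    (hF : IsLift (evaluation K (c.sec (cubeBase m))) 1 α F) :
    c.fibreIdentification n (Quotient.mk _ (hF.bottom (evaluation_one K _))) =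
      (samelsonProduct (show π_ (n + 1) K (1 : K) from Quotient.mk _ α) b)⁻¹ := by
  obtain ⟨β, γ, rfl, hγ, hγ0, hγ1⟩ := hb
  obtain ⟨G, hGx, hGy⟩ := c.exists_deformed_lift hF hγ.homotopic
  have hG1 : ∀ x y, x (Fin.last n) = 1 ∨ (∃ i : Fin n, x i.castSucc = 0 ∨ x i.castSucc = 1) →
      G (x, y) * (α x)⁻¹ = 1 := by
    intro x y hx
    have hFx : F x = 1 := hx.elim (hF.last_eq_one x) (hF.side x)
    have hxb : x ∈ Cube.boundary (Fin (n + 1)) := by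
      rcases hx with h | ⟨i, hi⟩
      exacts [⟨_, Or.inr h⟩, ⟨_, hi⟩]
    have hα : α x = 1 := α.2 x hxb
    rw [hGx x hxb y, hFx, hα]
    simp
  have hG2 : ∀ x (y : Cube.boundary (Fin (m + 1))), γ y = 1 → G (x, y) * (α x)⁻¹ = 1 := by
    intro x y hy
    simp [hGy, hy]
  let e : Fin (n + 1) ⊕ Fin m ≃ Fin (n + m + 1) := finSumFinEquiv.trans (finCongr (by omega))
  let comm : Ω^ (Fin (n + m + 1)) K (1 : K) := GenLoop.congr 1 e (commutatorLoop α β)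
  let commInv : Ω^ (Fin (n + m + 1)) K (1 : K) :=
    ⟨comm.1⁻¹, fun y hy => by
      have h : comm.1 y = 1 := comm.2 y hy
      simp [h]⟩
  refine Eq.trans (Quotient.sound ?_) (inv_mk_eq_mk_of_pointwise_inv comm commInv fun _ => rfl).symm
  let xc : I → (I^ (Fin (n + m + 1))) → I^ (Fin (n + 1)) := fun s w =>
    Fin.snoc (fun i => w (Fin.castAdd (m + 1) i)) s
  let yc : I → (I^ (Fin (n + m + 1))) → I^ (Fin (m + 1)) := fun t w =>
    Fin.cons t (fun j => w (Fin.natAdd n j.succ))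
  let q : C((I × I) × (I^ (Fin (n + m + 1))), K) :=
    ⟨fun z => G (xc z.1.1 z.2, yc z.1.2 z.2) * (α (xc z.1.1 z.2))⁻¹, by
      have h1 : Continuous fun z : (I × I) × (I^ (Fin (n + m + 1))) => xc z.1.1 z.2 := by fun_prop
      have h2 : Continuous fun z : (I × I) × (I^ (Fin (n + m + 1))) => yc z.1.2 z.2 := by fun_prop
      exact (G.continuous.comp (h1.prodMk h2)).mul (α.1.continuous.comp h1).inv⟩
  have hβ : ∀ (y : Cube.boundary (Fin (m + 1))), Fin.tail y.1 ∈ Cube.boundary (Fin m) →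
      γ y = 1 := by
    intro y hy
    by_cases h : y.1 0 = 0
    · exact (hγ0 y h).trans (β.2 _ hy)
    · exact hγ1 y h
  have hbot : ∀ s w, xc s w (Fin.last n) = s := fun s w => by simp [xc]
  refine homotopic_of_square (Fin.natAdd n 0 : Fin (n + (m + 1))) q _ _ ?_ ?_ ?_ ?_ ?_ ?_
  · intro w
    have hxb : xc 0 w ∈ Cube.boundary (Fin (n + 1)) := ⟨Fin.last n, Or.inl (hbot 0 w)⟩
    have hα : α (xc 0 w) = 1 := α.2 _ hxb
    have hy : yc (w (Fin.natAdd n 0 : Fin (n + (m + 1)))) w = fun j => w (Fin.natAdd n j) :=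
      Fin.cons_self_tail (fun j => w (Fin.natAdd n j))
    change _ = G (xc 0 w, yc _ w) * (α (xc 0 w))⁻¹
    rw [hα, hGx _ hxb, hy, inv_one, mul_one]
    rfl
  · intro w
    have hx : xc (w (Fin.natAdd n 0 : Fin (n + (m + 1)))) w = fun i => w (e (Sum.inl i)) := by
      funext i
      refine Fin.lastCases ?_ (fun i => ?_) i
      · rw [hbot]
        exact congrArg w (Fin.ext (by simp [e]))
      · simp only [xc, Fin.snoc_castSucc]
        exact congrArg w (Fin.ext (by simp [e]))
    have hy : (fun j : Fin m => w (Fin.natAdd n j.succ : Fin (n + (m + 1)))) =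
        fun j => w (e (Sum.inr j)) :=
      funext fun j => congrArg w (Fin.ext (by simp [e]; omega))
    have hγy : γ ⟨yc 0 w, 0, Or.inl rfl⟩ = β fun j => w (e (Sum.inr j)) :=
      (hγ0 _ rfl).trans (congrArg β hy)
    change (α (fun i => w (e (Sum.inl i))) * β (fun j => w (e (Sum.inr j))) *
      (α fun i => w (e (Sum.inl i)))⁻¹ * (β fun j => w (e (Sum.inr j)))⁻¹)⁻¹ =
      G (xc _ w, yc 0 w) * (α (xc _ w))⁻¹
    rw [hGy _ ⟨yc 0 w, 0, Or.inl rfl⟩, hγy, hx]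
    group
  · intro w
    have hxb : xc 0 w ∈ Cube.boundary (Fin (n + 1)) := ⟨Fin.last n, Or.inl (hbot 0 w)⟩
    have hα : α (xc 0 w) = 1 := α.2 _ hxb
    change G (xc 0 w, yc 0 w) * (α (xc 0 w))⁻¹ = 1
    rw [hGy _ ⟨yc 0 w, 0, Or.inl rfl⟩, hα]
    simp
  · intro t w
    exact hG1 _ _ (Or.inl (hbot 1 w))
  · intro s w
    exact hG2 (xc s w) ⟨yc 1 w, 0, Or.inr rfl⟩ (hγ1 _ one_ne_zero)
  · rintro s t w ⟨k, hk, hwk⟩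
    change G (xc s w, yc t w) * (α (xc s w))⁻¹ = 1
    revert hk hwk
    refine Fin.addCases (m := n) (n := m + 1) (fun i _ hi => ?_) (fun j => ?_) k
    · exact hG1 _ _ (Or.inr ⟨i, by simpa [xc] using hi⟩)
    · refine Fin.cases (fun h => absurd rfl h) (fun j _ hj => ?_) j
      have hyt : Fin.tail (yc t w) ∈ Cube.boundary (Fin m) := ⟨j, hj⟩
      have hyb : yc t w ∈ Cube.boundary (Fin (m + 1)) := ⟨j.succ, hj⟩
      exact hG2 _ ⟨_, hyb⟩ (hβ ⟨_, hyb⟩ hyt)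

end CharacteristicMap

end SamelsonGauge

end

theorem mainTheorem1 {K P : Type*} [Group K] [TopologicalSpace K] [IsTopologicalGroup K]
    [TopologicalSpace P] [MulAction Kᵐᵒᵖ P] (hK : LocallyContractibleSpace K)
    (m n : ℕ) (η : P → SamelsonGauge.Sph (m + 1))
    (hη : SamelsonGauge.IsPrincipalBundle K η)
    (c : SamelsonGauge.CharacteristicMap K η)
    (b : HomotopyGroup.Pi m K (1 : K)) (hb : c.Represents b) :
    SamelsonGauge.IsSerreFibration
      (SamelsonGauge.evaluation K (c.sec (SamelsonGauge.cubeBase m))) ∧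
    IsHomeomorph c.fibreMap ∧
    ∃ δ : HomotopyGroup.Pi (n + 1) K (1 : K) →
        HomotopyGroup.Pi n c.PointedGauge ⟨1, SamelsonGauge.evaluation_one K _⟩,
      SamelsonGauge.IsConnectingMap
        (SamelsonGauge.evaluation K (c.sec (SamelsonGauge.cubeBase m)))
        (SamelsonGauge.evaluation_one K _) n δ ∧
      ∀ a : HomotopyGroup.Pi (n + 1) K (1 : K),
        c.fibreIdentification n (δ a) = (SamelsonGauge.samelsonProduct a b)⁻¹ := by
  refine ⟨c.isSerreFibration_evaluation hη, c.isHomeomorph_fibreMap hη, ?_⟩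
  choose F hF using fun α : GenLoop (Fin (n + 1)) K (1 : K) => c.exists_isLift hη α
  -- `δ` is defined by the lift of one chosen representative of each class.
  let δ : HomotopyGroup.Pi (n + 1) K (1 : K) →
      HomotopyGroup.Pi n c.PointedGauge ⟨1, SamelsonGauge.evaluation_one K _⟩ := fun a =>
    Quotient.mk _ ((hF a.out).bottom (SamelsonGauge.evaluation_one K _))
  have hδ : ∀ a, c.fibreIdentification n (δ a) = (SamelsonGauge.samelsonProduct a b)⁻¹ := fun a =>
    (c.fibreIdentification_bottom hb a.out (hF a.out)).trans
      (congrArg (fun a' => (SamelsonGauge.samelsonProduct a' b)⁻¹) (Quotient.out_eq a))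
  -- Any other lift of any other representative gives an element with the same image under the
  -- injective identification.
  refine ⟨δ, fun α => ⟨⟨F α, hF α⟩, fun F' hF' => c.fibreIdentification_injective hη n ?_⟩, hδ⟩
  exact (hδ _).trans (c.fibreIdentification_bottom hb α hF').symm
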